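/- **Proposition (composition of the two-type Yule process).** Consider particles of two types, $\mathsf x$ and $\mathsf y$. Each particle lives, independently of all others, an exponential time of rate $1$ and then disintegrates into two particles of the other type. At time $0$ there is a single particle, of type $\mathsf x$. For $t\ge 0$ let $N_t\in\{0,1,2,\dots\}\cup\{\infty\}$ be the number of particles of type $\mathsf x$ present at time $t$. Let $H_{n,k}$ be the number of histories of length $n$ of the urn in which, at each step, one ball is chosen and replaced by two balls of the other type ($\mathsf x\to\mathsf y\mathsf y$, $\mathsf y\to\mathsf x\mathsf x$), that start with one ball $\mathsf x$ and end with exactly $k$ balls $\mathsf x$ and $n+1-k$ balls $\mathsf y$ (a history records which ball of the current word is replaced at each step). Let $\operatorname{sm}$ be Dixon's function on the real line, that is, the first component of the solution of $\operatorname{sm}'=\operatorname{cm}^2$, $\operatorname{cm}'=-\operatorname{sm}^2$, $\operatorname{sm}(0)=0$, $\operatorname{cm}(0)=1$ on its maximal interval of existence, and let $\operatorname{smh}(z)=-\operatorname{sm}(-z)$. Then for every $t\ge0$ the following hold. 1. For every complex $x$ with $|x|\le1$, the double series $\sum_{n,k\ge0}H_{n,k}x^k\frac{(1-e^{-t})^n}{n!}$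 converges absolutely, and $$\sum_{k\ge0}\mathbb P(N_t=k)\,x^k \;=\; e^{-t}\sum_{n,k\ge0}H_{n,k}\,x^k\,\frac{(1-e^{-t})^n}{n!}.$$ (For $x=1$ this contains $\mathbb P(N_t<\infty)=1$.) 2. For every real $x$ with $|x|<1$, the probability generating function of $N_t$ is $$\sum_{k\ge0}\mathbb P(N_t=k)\,x^k \;=\; e^{-t}(1-x^3)^{1/3}\operatorname{smh}\!\left((1-x^3)^{1/3}(1-e^{-t})+\int_0^{x(1-x^3)^{-1/3}}\frac{ds}{(1+s^3)^{2/3}}\right).$$ -/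

import Mathlib

open MeasureTheory ProbabilityTheory Set

noncomputable section

/-! ### The two types -/

/-- The two types of balls of the urn (equivalently, of particles): `x` is the first type,
`y` is the second type. -/
inductive Ball
  | x
  | y
  deriving DecidableEq

/-- The opposite type. -/
def Ball.other : Ball → Ball
  | .x => .y
  | .y => .x

/-! ### The urn with placement matrix `(-1, 2; 2, -1)` -/

/-- Apply one of the rules `x → yy`, `y → xx` to the letter of the word `w` at position `i`. -/
def urnReplace (w : List Ball) (i : ℕ) : List Ball :=
  match w.drop i with
  | [] => w
  | b :: v => w.take i ++ b.other :: b.other :: v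

/-- A history of length `n` of the urn started with one ball: at step `i` (counted from `0`) the
current word has `i + 1` letters, and the history records the position of the letter
that is replaced. -/
abbrev UrnHistory (n : ℕ) : Type := (i : Fin n) → Fin (i + 1)

/-- The word reached by a history that starts with the one-letter word `x`. -/
def UrnHistory.word {n : ℕ} (h : UrnHistory n) : List Ball :=
  (List.ofFn fun i => (h i : ℕ)).foldl urnReplace [Ball.x]

/-- `urnCount n k` is the number of histories of length `n` that start with the word `x` and end
in a word with exactly `k` letters `x`. -/
def urnCount (n k : ℕ) : ℕ :=
  Fintype.card {h : UrnHistory n // h.word.count Ball.x = k}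

/-! ### The Dixonian functions on the real line -/

/-- `s, c` solve Dixon's system `s' = c ^ 2`, `c' = - s ^ 2`, `s 0 = 0`, `c 0 = 1` on the open
interval `(a, b)`, which contains `0`. -/
structure IsDixonSolution (a b : ℝ) (s c : ℝ → ℝ) : Prop where
  left_neg : a < 0
  right_pos : 0 < b
  s_zero : s 0 = 0
  c_zero : c 0 = 1
  hasDerivAt_s : ∀ z ∈ Ioo a b, HasDerivAt s (c z ^ 2) z
  hasDerivAt_c : ∀ z ∈ Ioo a b, HasDerivAt c (-s z ^ 2) z

/-- Two solutions of Dixon's system agree where both are defined. -/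
theorem IsDixonSolution.eq {a b a' b' : ℝ} {s c s' c' : ℝ → ℝ}
    (h : IsDixonSolution a b s c) (h' : IsDixonSolution a' b' s' c') {z : ℝ}
    (hz : z ∈ Ioo a b) (hz' : z ∈ Ioo a' b') : s z = s' z := by
  set v : ℝ × ℝ → ℝ × ℝ := fun p => (p.2 ^ 2, -p.1 ^ 2) with hv
  have hvl : LocallyLipschitz v :=
    (show ContDiff ℝ 1 v by rw [hv]; fun_prop).locallyLipschitz
  -- both solutions on the common interval `I`
  have hI : ∀ u ∈ Ioo (max a a') (min b b'), u ∈ Ioo a b ∧ u ∈ Ioo a' b' := fun u hu =>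
    ⟨⟨(le_max_left _ _).trans_lt hu.1, hu.2.trans_le (min_le_left _ _)⟩,
      ⟨(le_max_right _ _).trans_lt hu.1, hu.2.trans_le (min_le_right _ _)⟩⟩
  have h0 : (0 : ℝ) ∈ Ioo (max a a') (min b b') :=
    ⟨max_lt h.left_neg h'.left_neg, lt_min h.right_pos h'.right_pos⟩
  have hzI : z ∈ Ioo (max a a') (min b b') :=
    ⟨max_lt hz.1 hz'.1, lt_min hz.2 hz'.2⟩
  have d1 : ∀ u ∈ Ioo (max a a') (min b b'),
      HasDerivAt (fun u => (s u, c u)) (v (s u, c u)) u := fun u hu =>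
    (h.hasDerivAt_s u (hI u hu).1).prodMk (h.hasDerivAt_c u (hI u hu).1)
  have d2 : ∀ u ∈ Ioo (max a a') (min b b'),
      HasDerivAt (fun u => (s' u, c' u)) (v (s' u, c' u)) u := fun u hu =>
    (h'.hasDerivAt_s u (hI u hu).2).prodMk (h'.hasDerivAt_c u (hI u hu).2)
  obtain ⟨p, hp, hp'⟩ := exists_between (lt_min h0.1 hzI.1)
  obtain ⟨q, hq', hq⟩ := exists_between (max_lt h0.2 hzI.2)
  have hsub : Icc p q ⊆ Ioo (max a a') (min b b') := fun u hu =>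
    ⟨hp.trans_le hu.1, hu.2.trans_lt hq⟩
  have hK : IsCompact ((fun u => (s u, c u)) '' Icc p q ∪ (fun u => (s' u, c' u)) '' Icc p q) :=
    (isCompact_Icc.image_of_continuousOn
      fun u hu => (d1 u (hsub hu)).continuousAt.continuousWithinAt).union
    (isCompact_Icc.image_of_continuousOn
      fun u hu => (d2 u (hsub hu)).continuousAt.continuousWithinAt)
  obtain ⟨K, hKv⟩ := hvl.locallyLipschitzOn.exists_lipschitzOnWith_of_compact hK
  have key := ODE_solution_unique_of_mem_Ioo (v := fun _ => v) (s := fun _ => _) (t₀ := 0)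
    (a := p) (b := q) (fun _ _ => hKv)
    ⟨hp'.trans_le (min_le_left _ _), (le_max_left _ _).trans_lt hq'⟩
    (fun u hu => ⟨d1 u (hsub (Ioo_subset_Icc_self hu)),
      Or.inl ⟨u, Ioo_subset_Icc_self hu, rfl⟩⟩)
    (fun u hu => ⟨d2 u (hsub (Ioo_subset_Icc_self hu)),
      Or.inr ⟨u, Ioo_subset_Icc_self hu, rfl⟩⟩)
    (by simp [h.s_zero, h.c_zero, h'.s_zero, h'.c_zero])
  exact congrArg Prod.fst
    (key (x := z) ⟨hp'.trans_le (min_le_right _ _), (le_max_right _ _).trans_lt hq'⟩)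

open Classical in
/-- Dixon's function `sm` on the real line: the first component of the solution of
`sm' = cm ^ 2`, `cm' = - sm ^ 2`, `sm 0 = 0`, `cm 0 = 1`, at every point of its maximal interval of
existence (and the placeholder value `0` elsewhere). -/
def dixonSm (z : ℝ) : ℝ :=
  if h : ∃ v : ℝ, ∃ (a b : ℝ) (s c : ℝ → ℝ), IsDixonSolution a b s c ∧ z ∈ Ioo a b ∧ s z = v
  then h.choose else 0

/-- `dixonSm` agrees with every solution of Dixon's system. -/
theorem IsDixonSolution.dixonSm_eq {a b : ℝ} {s c : ℝ → ℝ} (h : IsDixonSolution a b s c) {z : ℝ}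
    (hz : z ∈ Ioo a b) : dixonSm z = s z := by
  have hex : ∃ v : ℝ, ∃ (a b : ℝ) (s c : ℝ → ℝ),
      IsDixonSolution a b s c ∧ z ∈ Ioo a b ∧ s z = v := ⟨s z, a, b, s, c, h, hz, rfl⟩
  obtain ⟨a', b', s', c', h', hz', hv⟩ := hex.choose_spec
  rw [dixonSm, dif_pos hex, ← hv]
  exact h'.eq h hz' hz

/-- The function `smh z = - sm (- z)`. -/
def dixonSmh (z : ℝ) : ℝ := -dixonSm (-z)

/-- The closed form `(1 - x^3)^(1/3) smh ((1 - x^3)^(1/3) z + ∫_0^(x (1 - x^3)^(-1/3)) ds / (1 + s^3)^(2/3))`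
of the bivariate generating function of urn histories. -/
def urnClosedForm (x z : ℝ) : ℝ :=
  (1 - x ^ 3) ^ (1 / 3 : ℝ) *
    dixonSmh ((1 - x ^ 3) ^ (1 / 3 : ℝ) * z +
      ∫ s in (0 : ℝ)..(x * (1 - x ^ 3) ^ (-(1 / 3) : ℝ)), 1 / (1 + s ^ 3) ^ (2 / 3 : ℝ))

/-! ### The two-type Yule process -/

/-- A particle is named by its line of descent: `[]` is the initial particle, and the two offspring
of `v` are `false :: v` and `true :: v`. -/
abbrev Particle : Type := List Bool

/-- The type of a particle: the initial one has type `x`, and a particle disintegrates into two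
particles of the other type. -/
def Particle.type : Particle → Ball
  | [] => Ball.x
  | _ :: v => (Particle.type v).other

/-- The time of birth of a particle, given the lifetimes `T` of all particles: the initial particle
is born at time `0`, and the others at the moment at which their parent disintegrates. -/
def birthTime (T : Particle → ℝ) : Particle → ℝ
  | [] => 0
  | _ :: v => birthTime T v + T v

/-- The set of particles that are present at time `t`, given the lifetimes `T`. -/
def aliveAt (T : Particle → ℝ) (t : ℝ) : Set Particle :=
  {v | birthTime T v ≤ t ∧ t < birthTime T v + T v}

/-- The number of particles of type `x` that are present at time `t`. -/
def yuleCount (T : Particle → ℝ) (t : ℝ) : ℕ∞ :=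
  {v ∈ aliveAt T t | Particle.type v = Ball.x}.encard

/-- The random lifetimes that drive the Yule process: they are independent, and each is exponential
of rate `1`. -/
structure IsYuleLifetimes {Ω : Type*} [MeasurableSpace Ω] (μ : Measure Ω)
    (T : Particle → Ω → ℝ) : Prop where
  hasLaw : ∀ v, HasLaw (T v) (expMeasure 1) μ
  indep : iIndepFun T μ

end

/-! Both sides solve the same quadratic system, once for the urn and once for the process. Urn: one
step acts on monomials as the derivation `D = y² ∂/∂x + x² ∂/∂y`, so the histories of length `n`
from a ball `b` have total weight `D^n b` at the point `(x, 1)`. Since `D b` is the square of the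
other letter, Leibniz makes the exponential generating functions `X`, `Y` of the two starting balls
satisfy `X' = Y²`, `Y' = X²`, `X(0) = x`, `Y(0) = 1` (`hasDerivAt_urnSeries`). For `|x| ≤ 1` their
coefficients have norm at most `1`, which gives convergence on the unit disc.

Process: conditioning on the lifetime of the initial particle gives a branching integral equation
(`typePGF_eq`). The functions `e^{-t} X(1 - e^{-t})` and `e^{-t} Y(1 - e^{-t})` solve it too
(`urnSeries_branching`), and a Picard iteration shows that bounded solutions are unique
(`norm_typePGF_sub_le`).

Closed form: `Y³ - X³` is a first integral with value `1 - x³ = m³`. So `X/m` satisfies an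
autonomous equation, which the Abelian integral inverse to `smh` linearises (`dixonSmh_dixonArcsmh`,
`urnClosedForm_eq_urnSeries`). -/

open Finset in
/-- The Leibniz rule for the iterates of a derivation. -/
theorem Derivation.iterate_mul {R A : Type*} [CommSemiring R] [CommSemiring A] [Algebra R A]
    (D : Derivation R A A) (n : ℕ) (a b : A) :
    D^[n] (a * b) = ∑ p ∈ antidiagonal n, n.choose p.1 • (D^[p.1] a * D^[p.2] b) := by
  induction n with
  | zero => simp
  | succ n ih =>
    rw [Function.iterate_succ_apply', ih,
      Finset.sum_antidiagonal_choose_succ_nsmul (fun i j => D^[i] a * D^[j] b), map_sum,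
      ← Finset.sum_add_distrib]
    refine Finset.sum_congr rfl fun p hp => ?_
    have hc : n.choose p.2 = n.choose p.1 := by
      rw [← mem_antidiagonal.1 hp, Nat.choose_symm_add]
    rw [map_nsmul, Derivation.leibniz, hc, Function.iterate_succ_apply',
      Function.iterate_succ_apply', smul_add, smul_eq_mul, smul_eq_mul,
      mul_comm (D^[p.2] b)]

/-! ### Urn histories as iterates of a derivation, and bounds on their weights -/

noncomputable section

/-- The monomial that records the composition of a word. -/
def urnMonomial (w : List Ball) : MvPolynomial Ball ℕ := (w.map MvPolynomial.X).prod

/-- The derivation `y² ∂/∂x + x² ∂/∂y`, which describes one step of the urn. -/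
def urnDerivation : Derivation ℕ (MvPolynomial Ball ℕ) (MvPolynomial Ball ℕ) :=
  MvPolynomial.mkDerivation ℕ fun b => MvPolynomial.X b.other ^ 2

theorem urnReplace_cons_succ (b : Ball) (v : List Ball) (i : ℕ) :
    urnReplace (b :: v) (i + 1) = b :: urnReplace v i := by
  unfold urnReplace
  rw [List.drop_succ_cons]
  cases v.drop i <;> simp

/-- The Leibniz rule differentiates one letter at a time, and differentiating a letter is the
replacement rule of the urn. -/
theorem urnDerivation_urnMonomial (w : List Ball) :
    urnDerivation (urnMonomial w) = ∑ i ∈ Finset.range w.length, urnMonomial (urnReplace w i) := by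
  induction w with
  | nil => simp [urnMonomial]
  | cons b v ih =>
    have h (c : Ball) (u : List Ball) : urnMonomial (c :: u) = MvPolynomial.X c * urnMonomial u := by
      simp [urnMonomial]
    rw [h, Derivation.leibniz, ih, List.length_cons, Finset.sum_range_succ']
    simp only [urnReplace_cons_succ, h, smul_eq_mul, Finset.mul_sum]
    congr 1
    simp only [urnDerivation, MvPolynomial.mkDerivation_X, urnReplace, List.drop_zero,
      List.take_zero, List.nil_append, h]
    ring

theorem length_urnReplace {w : List Ball} {i : ℕ} (hi : i < w.length) :
    (urnReplace w i).length = w.length + 1 := by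
  induction w generalizing i with
  | nil => simp at hi
  | cons b v ih =>
    cases i with
    | zero => simp [urnReplace]
    | succ i => rw [urnReplace_cons_succ, List.length_cons, ih (by simpa using hi), List.length_cons]

theorem UrnHistory.word_snoc {n : ℕ} (h : UrnHistory n) (j : Fin (n + 1)) :
    UrnHistory.word (n := n + 1) (Fin.snoc (α := fun i : Fin (n + 1) => Fin (i + 1)) h j) =
      urnReplace h.word j := by
  unfold UrnHistory.word
  rw [List.ofFn_succ', List.concat_eq_append, List.foldl_append]
  simp

theorem UrnHistory.length_word {n : ℕ} (h : UrnHistory n) : h.word.length = n + 1 := by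
  induction n with
  | zero => simp [UrnHistory.word]
  | succ n ih =>
    rw [← Fin.snoc_init_self h, UrnHistory.word_snoc, length_urnReplace, ih]
    rw [ih]
    exact (h (Fin.last n)).2

theorem sum_urnMonomial_word (n : ℕ) :
    ∑ h : UrnHistory n, urnMonomial h.word = urnDerivation^[n] (MvPolynomial.X Ball.x) := by
  induction n with
  | zero => simp [UrnHistory.word, urnMonomial]
  | succ n ih =>
    rw [Function.iterate_succ_apply', ← ih, map_sum,
      ← (Fin.snocEquiv fun i : Fin (n + 1) => Fin (i + 1)).sum_comp, Fintype.sum_prod_type,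
      Finset.sum_comm]
    refine Finset.sum_congr rfl fun h _ => ?_
    rw [urnDerivation_urnMonomial, UrnHistory.length_word, Finset.sum_range]
    exact Finset.sum_congr rfl fun j _ => congrArg urnMonomial (UrnHistory.word_snoc h j)

/-- The evaluation point that gives weight `x` to the first type and `1` to the second. -/
def urnWeight {R : Type*} [One R] (x : R) : Ball → R
  | .x => x
  | .y => 1

/-- The total weight of the histories of length `n` that start with the ball `b`. -/
def urnWeightSum {R : Type*} [CommSemiring R] (x : R) (b : Ball) (n : ℕ) : R :=
  MvPolynomial.aeval (urnWeight x) (urnDerivation^[n] (MvPolynomial.X b))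

section
variable {R : Type*} [CommSemiring R]

theorem urnWeightSum_zero (x : R) (b : Ball) : urnWeightSum x b 0 = urnWeight x b := by
  simp [urnWeightSum]

/-- Here the first step is split off, not the last: it yields two balls of the other type, and the
binomial counts the ways to interleave their two histories. -/
theorem urnWeightSum_succ (x : R) (b : Ball) (n : ℕ) :
    urnWeightSum x b (n + 1) = ∑ p ∈ Finset.HasAntidiagonal.antidiagonal n,
      n.choose p.1 • (urnWeightSum x b.other p.1 * urnWeightSum x b.other p.2) := by
  unfold urnWeightSum
  rw [Function.iterate_succ_apply]
  conv_lhs => rw [urnDerivation, MvPolynomial.mkDerivation_X, ← urnDerivation, sq,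
    Derivation.iterate_mul, map_sum]
  simp

theorem aeval_urnMonomial (x : R) (w : List Ball) :
    MvPolynomial.aeval (urnWeight x) (urnMonomial w) = x ^ w.count Ball.x := by
  induction w with
  | nil => simp [urnMonomial]
  | cons b v ih =>
    have h : urnMonomial (b :: v) = MvPolynomial.X b * urnMonomial v := by simp [urnMonomial]
    rw [h, map_mul, ih, MvPolynomial.aeval_X]
    cases b <;> simp [urnWeight, pow_succ']

theorem urnWeightSum_eq_sum (x : R) (n : ℕ) :
    urnWeightSum x Ball.x n = ∑ h : UrnHistory n, x ^ h.word.count Ball.x := by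
  rw [urnWeightSum, ← sum_urnMonomial_word, map_sum]
  exact Finset.sum_congr rfl fun h _ => aeval_urnMonomial x _

theorem hasSum_urnCount [TopologicalSpace R] [ContinuousAdd R] (x : R) (n : ℕ) :
    HasSum (fun k => (urnCount n k : R) * x ^ k) (urnWeightSum x Ball.x n) := by
  rw [urnWeightSum_eq_sum]
  have h (k : ℕ) : (urnCount n k : R) * x ^ k =
      ∑ h : UrnHistory n, if k = h.word.count Ball.x then x ^ h.word.count Ball.x else 0 := by
    rw [urnCount, Fintype.card_subtype, ← nsmul_eq_mul, ← Finset.sum_const, Finset.sum_filter]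
    refine Finset.sum_congr rfl fun h _ => ?_
    by_cases hk : k = h.word.count Ball.x
    · simp [hk]
    · rw [if_neg hk, if_neg (Ne.symm hk)]
  simp_rw [h]
  exact hasSum_sum fun h _ => hasSum_ite_eq _ _

end

section
variable {𝕜 : Type*} [RCLike 𝕜]

/-- The coefficient of the exponential generating function of urn histories from the ball `b`. -/
def urnCoeff (x : 𝕜) (b : Ball) (n : ℕ) : 𝕜 := urnWeightSum x b n / (n.factorial : 𝕜)

theorem urnCoeff_zero (x : 𝕜) (b : Ball) : urnCoeff x b 0 = urnWeight x b := by
  simp [urnCoeff, urnWeightSum_zero]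

theorem urnCoeff_succ (x : 𝕜) (b : Ball) (n : ℕ) :
    ((n : 𝕜) + 1) * urnCoeff x b (n + 1) =
      ∑ p ∈ Finset.HasAntidiagonal.antidiagonal n, urnCoeff x b.other p.1 * urnCoeff x b.other p.2 := by
  have hn : ((n : 𝕜) + 1) ≠ 0 := by exact_mod_cast n.succ_ne_zero
  have hf (m : ℕ) : (m.factorial : 𝕜) ≠ 0 := by exact_mod_cast m.factorial_ne_zero
  unfold urnCoeff
  rw [urnWeightSum_succ, Nat.factorial_succ, Finset.sum_div, Finset.mul_sum]
  refine Finset.sum_congr rfl fun p hp => ?_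
  have hp' := Finset.HasAntidiagonal.mem_antidiagonal.1 hp
  have hc : (n.choose p.1 : 𝕜) * (p.1.factorial * p.2.factorial) = n.factorial := by
    have := Nat.add_choose_mul_factorial_mul_factorial p.1 p.2
    rw [← Nat.choose_symm_add, hp'] at this
    rw [← mul_assoc]
    exact_mod_cast this
  rw [nsmul_eq_mul, Nat.cast_mul, ← hc]
  have := hf p.1
  have := hf p.2
  -- `n !` has been rewritten as a product containing this binomial, which `field_simp` must be able
  -- to cancel.
  have : (n.choose p.1 : 𝕜) ≠ 0 := fun h => hf n (by rw [← hc, h, zero_mul])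
  push_cast
  field_simp

/-- In the recurrence, the convolution has `n + 1` terms, each of norm at most `1` by induction, and
this is balanced by the factor `n + 1` on the left. -/
theorem norm_urnCoeff_le {x : 𝕜} (hx : ‖x‖ ≤ 1) (b : Ball) (n : ℕ) : ‖urnCoeff x b n‖ ≤ 1 := by
  induction n using Nat.strong_induction_on generalizing b with
  | _ n ih =>
    cases n with
    | zero => cases b <;> simp [urnCoeff_zero, urnWeight, hx]
    | succ n =>
      have hn : (0 : ℝ) < (n : ℝ) + 1 := by positivity
      have h := congrArg norm (urnCoeff_succ x b n)
      have hn' : ‖(n : 𝕜) + 1‖ = (n : ℝ) + 1 := by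
        have := RCLike.norm_natCast (K := 𝕜) (n + 1)
        push_cast at this
        exact this
      rw [norm_mul, hn'] at h
      have h2 : ‖∑ p ∈ Finset.HasAntidiagonal.antidiagonal n, urnCoeff x b.other p.1 * urnCoeff x b.other p.2‖
          ≤ ∑ p ∈ Finset.HasAntidiagonal.antidiagonal n, (1 : ℝ) := by
        refine norm_sum_le_of_le _ fun p hp => ?_
        have := Finset.HasAntidiagonal.mem_antidiagonal.1 hp
        rw [norm_mul]
        exact mul_le_one₀ (ih _ (by omega) _) (norm_nonneg _) (ih _ (by omega) _)
      rw [← h] at h2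
      simp only [Finset.sum_const, Finset.Nat.card_antidiagonal, nsmul_eq_mul, mul_one] at h2
      push_cast at h2
      exact le_of_mul_le_mul_left (h2.trans_eq (mul_one _).symm) hn

end
end

/-! ### The generating functions as a solution of `X' = Y²`, `Y' = X²` -/

noncomputable section

section
variable {𝕜 : Type*} [RCLike 𝕜]

/-- The exponential generating function of urn histories that start with the ball `b`. -/
def urnSeries (x : 𝕜) (b : Ball) (z : ℝ) : 𝕜 := ∑' n, z ^ n • urnCoeff x b n

theorem norm_smul_urnCoeff_le {x : 𝕜} (hx : ‖x‖ ≤ 1) (b : Ball) (z : ℝ) (n : ℕ) :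
    ‖z ^ n • urnCoeff x b n‖ ≤ |z| ^ n := by
  rw [norm_smul, norm_pow, Real.norm_eq_abs]
  exact mul_le_of_le_one_right (by positivity) (norm_urnCoeff_le hx b n)

theorem summable_norm_urnSeries {x : 𝕜} (hx : ‖x‖ ≤ 1) (b : Ball) {z : ℝ} (hz : |z| < 1) :
    Summable fun n => ‖z ^ n • urnCoeff x b n‖ :=
  (summable_geometric_of_lt_one (abs_nonneg z) hz).of_nonneg_of_le (fun _ => norm_nonneg _)
    (norm_smul_urnCoeff_le hx b z)

theorem urnSeries_zero (x : 𝕜) (b : Ball) : urnSeries x b 0 = urnWeight x b := by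
  unfold urnSeries
  rw [tsum_eq_single 0 fun n hn => by simp [hn]]
  simp [urnCoeff_zero]

/-- At `z = 1 - e^{-t}` the bound is `e^t`, exactly what the prefactor `e^{-t}` compensates in the
comparison with the process. -/
theorem norm_urnSeries_le {x : 𝕜} (hx : ‖x‖ ≤ 1) (b : Ball) {z : ℝ} (h0 : 0 ≤ z) (hz : z < 1) :
    ‖urnSeries x b z‖ ≤ (1 - z)⁻¹ := by
  rw [← tsum_geometric_of_lt_one h0 hz]
  refine tsum_of_norm_bounded (summable_geometric_of_lt_one h0 hz).hasSum fun n => ?_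
  simpa [abs_of_nonneg h0] using norm_smul_urnCoeff_le hx b z n

theorem hasSum_deriv_urnSeries {x : 𝕜} (hx : ‖x‖ ≤ 1) (b : Ball) {z : ℝ} (hz : |z| < 1) :
    HasSum (fun n : ℕ => (n * z ^ (n - 1)) • urnCoeff x b n) (urnSeries x b.other z ^ 2) := by
  have hs := summable_norm_urnSeries hx b.other hz
  have h (n : ℕ) : (((n + 1 : ℕ) : ℝ) * z ^ (n + 1 - 1)) • urnCoeff x b (n + 1) =
      ∑ p ∈ Finset.HasAntidiagonal.antidiagonal n,
        z ^ p.1 • urnCoeff x b.other p.1 * z ^ p.2 • urnCoeff x b.other p.2 := by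
    have h2 : (((n + 1 : ℕ) : ℝ) * z ^ (n + 1 - 1)) • urnCoeff x b (n + 1) =
        z ^ n • (((n : 𝕜) + 1) * urnCoeff x b (n + 1)) := by
      rw [Nat.add_sub_cancel, mul_comm, mul_smul]
      congr 1
      simp [RCLike.real_smul_eq_coe_mul]
    rw [h2, urnCoeff_succ, Finset.smul_sum]
    refine Finset.sum_congr rfl fun p hp => ?_
    rw [smul_mul_smul_comm, ← pow_add, Finset.HasAntidiagonal.mem_antidiagonal.1 hp]
  -- The term `n = 0` vanishes through its factor `n`, so the truncated exponent `n - 1` does no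
  -- harm there.
  rw [← hasSum_nat_add_iff' 1]
  simp only [h, Finset.sum_range_one, Nat.cast_zero, zero_mul, zero_smul, sub_zero, sq]
  rw [urnSeries, tsum_mul_tsum_eq_tsum_sum_antidiagonal_of_summable_norm hs hs]
  exact (summable_norm_sum_mul_antidiagonal_of_summable_norm hs hs).of_norm.hasSum

theorem hasDerivAt_urnSeries {x : 𝕜} (hx : ‖x‖ ≤ 1) (b : Ball) {z : ℝ} (hz : |z| < 1) :
    HasDerivAt (urnSeries x b) (urnSeries x b.other z ^ 2) z := by
  -- On the disc of radius `r < 1` the differentiated terms are dominated by the summable `n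
  -- r^(n-1)`.
  obtain ⟨r, hzr, hr⟩ := exists_between hz
  have hr0 : 0 < r := (abs_nonneg z).trans_lt hzr
  rw [← (hasSum_deriv_urnSeries hx b hz).tsum_eq]
  refine hasDerivAt_tsum_of_isPreconnected (𝕜 := ℝ) (g := fun n z => z ^ n • urnCoeff x b n)
    (g' := fun n z => (n * z ^ (n - 1)) • urnCoeff x b n)
    (t := Metric.ball 0 r) (y₀ := 0)
    (u := fun n : ℕ => n * r ^ (n - 1)) ?_ Metric.isOpen_ball
    (convex_ball 0 r).isPreconnected (fun n y _ => (hasDerivAt_pow n y).smul_const _) ?_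
    (Metric.mem_ball_self hr0) ?_ (by simpa using hzr)
  · have := summable_pow_mul_geometric_of_norm_lt_one 1 (r := r)
      (by rwa [Real.norm_of_nonneg hr0.le])
    refine (summable_nat_add_iff 1).1 ?_
    convert! ((summable_nat_add_iff 1).2 this).mul_left r⁻¹ using 2 with n
    rw [Nat.add_sub_cancel, pow_succ r n]
    field_simp
  · intro n y hy
    rw [norm_smul, norm_mul, norm_pow, Real.norm_natCast]
    have hy' : ‖y‖ ≤ r := by simpa using (mem_ball_zero_iff.1 hy).le
    calc _ ≤ (n * r ^ (n - 1)) * 1 := by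
          gcongr
          exact norm_urnCoeff_le hx b n
      _ = _ := mul_one _
  · exact (summable_norm_urnSeries hx b (by simp)).of_norm

/-- The double series of urn histories, summed over the lengths and the final compositions. -/
theorem hasSum_urnCount_prod {x : 𝕜} (hx : ‖x‖ ≤ 1) {z : ℝ} (h0 : 0 ≤ z) (hz : z < 1) :
    HasSum (fun p : ℕ × ℕ => (urnCount p.1 p.2 : 𝕜) * x ^ p.2 * (z : 𝕜) ^ p.1 /
      (p.1.factorial : 𝕜)) (urnSeries x Ball.x z) := by
  obtain ⟨F, hF⟩ : ∃ F : ℕ × ℕ → 𝕜, F = fun p => (urnCount p.1 p.2 : 𝕜) * x ^ p.2 *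
    (z : 𝕜) ^ p.1 / (p.1.factorial : 𝕜) := ⟨_, rfl⟩
  rw [← hF]
  have fiber (n : ℕ) : HasSum (fun k => F (n, k)) (z ^ n • urnCoeff x Ball.x n) := by
    have := ((hasSum_urnCount x n).mul_right ((z : 𝕜) ^ n)).div_const (n.factorial : 𝕜)
    convert! this using 1
    · ext k
      rw [hF]
    · rw [urnCoeff, RCLike.real_smul_eq_coe_mul, RCLike.ofReal_pow]
      ring
  -- The counts are nonnegative, so the norms form the same series at the parameter `‖x‖`, and the
  -- coefficient bound applies again.
  have fiber' (n : ℕ) : HasSum (fun k => ‖F (n, k)‖) (z ^ n * urnCoeff ‖x‖ Ball.x n) := by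
    have := ((hasSum_urnCount ‖x‖ n).mul_right (z ^ n)).div_const (n.factorial : ℝ)
    convert! this using 1
    · ext k
      simp [hF, abs_of_nonneg h0]
    · rw [urnCoeff]
      ring
  have hs : Summable F := by
    refine Summable.of_norm ?_
    have hn : Summable fun n => z ^ n * urnCoeff ‖x‖ Ball.x n := by
      refine (summable_geometric_of_lt_one h0 hz).of_norm_bounded fun n => ?_
      rw [norm_mul, Real.norm_of_nonneg (pow_nonneg h0 n)]
      exact mul_le_of_le_one_right (pow_nonneg h0 n) (norm_urnCoeff_le (by simpa using hx) _ n)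
    have hn' : Summable fun n => ∑' k, ‖F (n, k)‖ := by
      simp_rw [fun n => (fiber' n).tsum_eq]
      exact hn
    have h0 : (0 : ℕ × ℕ → ℝ) ≤ fun p => ‖F p‖ := fun p => norm_nonneg _
    rw [summable_prod_of_nonneg h0]
    exact ⟨fun n => (fiber' n).summable, hn'⟩
  have h2 := hs.hasSum.prod_fiberwise fiber
  rw [urnSeries, h2.tsum_eq]
  exact hs.hasSum

end

section
variable {x : ℝ}

/-- `Y³ - X³` has derivative `3Y²X² - 3X²Y² = 0`, and its value at `0` is `1 - x³`. -/
theorem urnSeries_y_cube (hx : |x| < 1) {z : ℝ} (h0 : 0 ≤ z) (hz : z < 1) :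
    urnSeries x Ball.y z ^ 3 = urnSeries x Ball.x z ^ 3 + (1 - x ^ 3) := by
  have hd (w : ℝ) (hw : w ∈ Ico 0 1) : HasDerivAt
      (fun w => urnSeries x Ball.y w ^ 3 - urnSeries x Ball.x w ^ 3) 0 w := by
    have hw' : |w| < 1 := by rw [abs_of_nonneg hw.1]; exact hw.2
    have h1 := hasDerivAt_urnSeries (x := x) hx.le Ball.x hw'
    have h2 := hasDerivAt_urnSeries (x := x) hx.le Ball.y hw'
    refine ((h2.fun_pow 3).fun_sub (h1.fun_pow 3)).congr_deriv ?_
    simp only [Ball.other]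
    ring
  have := (convex_Ico (0 : ℝ) 1).is_const_of_fderivWithin_eq_zero (𝕜 := ℝ)
    (f := fun w => urnSeries x Ball.y w ^ 3 - urnSeries x Ball.x w ^ 3)
    (fun w hw => (hd w hw).differentiableAt.differentiableWithinAt)
    (fun w hw => by
      rw [(hd w hw).hasFDerivAt.hasFDerivWithinAt.fderivWithin
        ((uniqueDiffOn_Ico 0 1) w hw)]
      ext; simp) (x := z) (y := 0) ⟨h0, hz⟩ ⟨le_rfl, one_pos⟩
  simp only [urnSeries_zero, urnWeight] at this
  linarith

/-- `Y' = X² ≥ 0` and `Y(0) = 1`. Positivity of `Y` is what later keeps `X/m` above `-1`, the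
singularity of the Abelian integral. -/
theorem one_le_urnSeries_y (hx : |x| < 1) {z : ℝ} (h0 : 0 ≤ z) (hz : z < 1) :
    1 ≤ urnSeries x Ball.y z := by
  have hd (w : ℝ) (hw : w ∈ Ico 0 1) :=
    hasDerivAt_urnSeries (x := x) hx.le Ball.y (z := w)
      (by rw [abs_of_nonneg hw.1]; exact hw.2)
  have := monotoneOn_of_deriv_nonneg (convex_Ico (0 : ℝ) 1)
    (fun w hw => (hd w hw).continuousAt.continuousWithinAt)
    (fun w hw => (hd w (interior_subset hw)).differentiableAt.differentiableWithinAt)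
    (fun w hw => by rw [(hd w (interior_subset hw)).deriv]; positivity)
    ⟨le_rfl, one_pos⟩ ⟨h0, hz⟩ h0
  simpa [urnSeries_zero, urnWeight] using this

end
end

/-! ### The Abelian integral and the closed form -/

noncomputable section

/-- The inverse of `smh`, as an Abelian integral. -/
def dixonArcsmh (u : ℝ) : ℝ := ∫ s in (0 : ℝ)..u, 1 / (1 + s ^ 3) ^ (2 / 3 : ℝ)

theorem one_add_cube_pos {u : ℝ} (hu : -1 < u) : 0 < 1 + u ^ 3 := by
  have h : 1 + u ^ 3 = (1 + u) * ((u - 1 / 2) ^ 2 + 3 / 4) := by ring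
  rw [h]
  exact mul_pos (by linarith) (by positivity)

theorem hasStrictDerivAt_dixonArcsmh {u : ℝ} (hu : -1 < u) :
    HasStrictDerivAt dixonArcsmh (1 / (1 + u ^ 3) ^ (2 / 3 : ℝ)) u := by
  have hc : ContinuousOn (fun s : ℝ => 1 / (1 + s ^ 3) ^ (2 / 3 : ℝ)) (Ioi (-1)) := by
    refine continuousOn_const.div (ContinuousOn.rpow_const (by fun_prop) fun s hs => ?_)
      fun s hs => ?_
    · exact Or.inl (one_add_cube_pos hs).ne'
    · exact (Real.rpow_pos_of_pos (one_add_cube_pos hs) _).ne'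
  refine intervalIntegral.integral_hasStrictDerivAt_right ?_ ?_
    (hc.continuousAt (Ioi_mem_nhds hu))
  · refine (hc.mono ?_).intervalIntegrable
    intro s hs
    exact (lt_min (by norm_num) hu).trans_le hs.1
  · exact hc.stronglyMeasurableAtFilter isOpen_Ioi u hu

theorem strictMonoOn_dixonArcsmh : StrictMonoOn dixonArcsmh (Ioi (-1)) := by
  refine strictMonoOn_of_deriv_pos (convex_Ioi _)
    (fun u hu => (hasStrictDerivAt_dixonArcsmh hu).hasDerivAt.continuousAt.continuousWithinAt)
    fun u hu => ?_
  have hu' : -1 < u := interior_subset hu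
  rw [(hasStrictDerivAt_dixonArcsmh hu').hasDerivAt.deriv]
  have := Real.rpow_pos_of_pos (one_add_cube_pos hu') (2 / 3)
  positivity

/-- The local inverse `σ` of the integral satisfies `σ' = (1 + σ³)^(2/3)`. After reflection it
becomes the first component of a solution of Dixon's system, and `dixonSm` agrees with any such
solution. -/
theorem dixonSmh_dixonArcsmh {u : ℝ} (hu : -1 < u) : dixonSmh (dixonArcsmh u) = u := by
  set σ : ℝ → ℝ := Function.invFunOn dixonArcsmh (Ioi (-1)) with hσ
  have hinv {v : ℝ} (hv : -1 < v) : σ (dixonArcsmh v) = v :=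
    strictMonoOn_dixonArcsmh.injOn.leftInvOn_invFunOn hv
  have hderiv {v : ℝ} (hv : -1 < v) :
      HasDerivAt σ ((1 + v ^ 3) ^ (2 / 3 : ℝ)) (dixonArcsmh v) := by
    have hpos := Real.rpow_pos_of_pos (one_add_cube_pos hv) (2 / 3)
    have := ((hasStrictDerivAt_dixonArcsmh hv).to_local_left_inverse (g := σ)
      (by positivity) ?_).hasDerivAt
    · simpa using this
    · filter_upwards [Ioi_mem_nhds hv] with w hw using hinv hw
  have h0 : dixonArcsmh 0 = 0 := by simp [dixonArcsmh]
  -- The interval between `p` and `q` must contain both `u` and `0`, because a Dixon solution lives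
  -- on an interval around its initial time.
  obtain ⟨p, hp, hpu⟩ := exists_between (lt_min hu (by norm_num : (-1 : ℝ) < 0))
  obtain ⟨q, huq⟩ := exists_gt (max u 0)
  have hpu' := hpu.trans_le (min_le_left _ _)
  have hp0 := hpu.trans_le (min_le_right _ _)
  have hqu := (le_max_left _ _).trans_lt huq
  have hq0 := (le_max_right _ _).trans_lt huq
  have hq : -1 < q := hu.trans hqu
  have hsurj {w : ℝ} (hw : w ∈ Ioo (-dixonArcsmh q) (-dixonArcsmh p)) :
      ∃ v, -1 < v ∧ dixonArcsmh v = -w := by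
    have hc : ContinuousOn dixonArcsmh (Icc p q) := fun v hv =>
      (hasStrictDerivAt_dixonArcsmh (hp.trans_le hv.1)).hasDerivAt.continuousAt.continuousWithinAt
    obtain ⟨v, hv, hvw⟩ := intermediate_value_Icc (hpu'.trans hqu).le hc
      (show -w ∈ Icc _ _ from ⟨by linarith [hw.2], by linarith [hw.1]⟩)
    exact ⟨v, hp.trans_le hv.1, hvw⟩
  have hσ0 : σ 0 = 0 := by simpa [h0] using hinv (v := 0) (by norm_num)
  -- The second component is forced by the first integral `s³ + c³ = 1`.
  have sol : IsDixonSolution (-dixonArcsmh q) (-dixonArcsmh p) (fun w => -σ (-w))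
      (fun w => (1 + σ (-w) ^ 3) ^ (1 / 3 : ℝ)) := by
    refine ⟨?_, ?_, by simp [hσ0], by simp [hσ0], ?_, ?_⟩
    · have := strictMonoOn_dixonArcsmh (show (0 : ℝ) ∈ Ioi (-1) by norm_num) hq hq0
      linarith
    · have := strictMonoOn_dixonArcsmh hp (show (0 : ℝ) ∈ Ioi (-1) by norm_num) hp0
      linarith
    · intro w hw
      obtain ⟨v, hv, hvw⟩ := hsurj hw
      have h := hderiv hv
      rw [hvw] at h
      have h' := (h.scomp w (hasDerivAt_neg w)).neg
      convert! h' using 1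
      have hpos := one_add_cube_pos hv
      rw [← hvw, hinv hv, ← Real.rpow_natCast, ← Real.rpow_mul hpos.le]
      norm_num
    · intro w hw
      obtain ⟨v, hv, hvw⟩ := hsurj hw
      have h := hderiv hv
      rw [hvw] at h
      have hpos := one_add_cube_pos hv
      have h' := (((h.scomp w (hasDerivAt_neg w)).fun_pow 3).const_add 1).rpow_const
        (p := 1 / 3) (Or.inl (by simp only [Function.comp]; rw [← hvw, hinv hv]; exact hpos.ne'))
      convert! h' using 1
      simp only [Function.comp]
      rw [← hvw, hinv hv]
      have h1 : (1 + v ^ 3) ^ (2 / 3 : ℝ) * (1 + v ^ 3) ^ (1 / 3 - 1 : ℝ) = 1 := by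
        rw [← Real.rpow_add hpos]
        norm_num
      simp only [smul_eq_mul]
      push_cast
      linear_combination v ^ 2 * h1
  have hmem : -dixonArcsmh u ∈ Ioo (-dixonArcsmh q) (-dixonArcsmh p) :=
    ⟨neg_lt_neg (strictMonoOn_dixonArcsmh hu hq hqu), neg_lt_neg (strictMonoOn_dixonArcsmh hp hu hpu')⟩
  rw [dixonSmh, sol.dixonSm_eq hmem]
  simp [hinv hu]

/-- The closed form of the exponential generating function of urn histories. -/
theorem urnClosedForm_eq_urnSeries {x : ℝ} (hx : |x| < 1) {z : ℝ} (h0 : 0 ≤ z) (hz : z < 1) :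
    urnClosedForm x z = urnSeries x Ball.x z := by
  have hx1 : x < 1 := (abs_lt.1 hx).2
  have hx3 : 0 < 1 - x ^ 3 := by
    have := one_add_cube_pos (u := -x) (by linarith)
    linarith [show (-x) ^ 3 = -x ^ 3 by ring]
  set m : ℝ := (1 - x ^ 3) ^ (1 / 3 : ℝ) with hm
  have hm0 : 0 < m := Real.rpow_pos_of_pos hx3 _
  have hm3 : m ^ 3 = 1 - x ^ 3 := by
    rw [hm, ← Real.rpow_natCast, ← Real.rpow_mul hx3.le]
    norm_num
  have hcube {w : ℝ} (hw : w ∈ Ico (0 : ℝ) 1) :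
      1 + (urnSeries x Ball.x w / m) ^ 3 = (urnSeries x Ball.y w / m) ^ 3 := by
    rw [div_pow, div_pow, urnSeries_y_cube hx hw.1 hw.2, ← hm3]
    field_simp
    ring
  have hYpos {w : ℝ} (hw : w ∈ Ico (0 : ℝ) 1) : 0 < urnSeries x Ball.y w / m :=
    div_pos (one_pos.trans_le (one_le_urnSeries_y hx hw.1 hw.2)) hm0
  have hgt {w : ℝ} (hw : w ∈ Ico (0 : ℝ) 1) : -1 < urnSeries x Ball.x w / m := by
    by_contra! h
    have h1 := pow_pos (hYpos hw) 3
    rw [← hcube hw] at h1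
    have h2 : (1 : ℝ) ≤ -(urnSeries x Ball.x w / m) := by linarith
    have h3 := one_le_pow₀ h2 (n := 3)
    linarith [show (-(urnSeries x Ball.x w / m)) ^ 3 = -(urnSeries x Ball.x w / m) ^ 3 by ring]
  -- `(X/m)' = Y²/m`, while the integrand at `X/m` is `(Y/m)^(-2)` by `hcube`; the product is the
  -- constant `m`.
  have hd (w : ℝ) (hw : w ∈ Ico (0 : ℝ) 1) :
      HasDerivAt (fun w => dixonArcsmh (urnSeries x Ball.x w / m) - m * w) 0 w := by
    have h1 := (hasDerivAt_urnSeries (x := x) hx.le Ball.x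
      (show |w| < 1 by rw [abs_of_nonneg hw.1]; exact hw.2)).div_const m
    have h2 := (hasStrictDerivAt_dixonArcsmh (hgt hw)).hasDerivAt.scomp w h1
    refine (h2.sub ((hasDerivAt_id w).const_mul m)).congr_deriv ?_
    rw [hcube hw, ← Real.rpow_natCast _ 3, ← Real.rpow_mul (hYpos hw).le]
    have := hYpos hw
    have hY : urnSeries x Ball.y w ≠ 0 := fun h => by simp [h] at this
    norm_num [Ball.other]
    field_simp
    ring
  have hconst := (convex_Ico (0 : ℝ) 1).is_const_of_fderivWithin_eq_zero (𝕜 := ℝ)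
    (f := fun w => dixonArcsmh (urnSeries x Ball.x w / m) - m * w)
    (fun w hw => (hd w hw).differentiableAt.differentiableWithinAt)
    (fun w hw => by
      rw [(hd w hw).hasFDerivAt.hasFDerivWithinAt.fderivWithin
        ((uniqueDiffOn_Ico 0 1) w hw)]
      ext; simp) (x := z) (y := 0) ⟨h0, hz⟩ ⟨le_rfl, one_pos⟩
  simp only [urnSeries_zero, urnWeight, mul_zero, sub_zero] at hconst
  have hI : m * z + dixonArcsmh (x * (1 - x ^ 3) ^ (-(1 / 3) : ℝ)) =
      dixonArcsmh (urnSeries x Ball.x z / m) := by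
    rw [Real.rpow_neg hx3.le, ← hm, ← div_eq_mul_inv, ← hconst]
    ring
  rw [urnClosedForm, ← hm]
  change m * dixonSmh (m * z + dixonArcsmh _) = _
  rw [hI, dixonSmh_dixonArcsmh (hgt ⟨h0, hz⟩)]
  field_simp

end

noncomputable section

/-! ### The branching property of the particle counts -/

theorem Particle.type_concat (v : Particle) (b : Bool) :
    Particle.type (v ++ [b]) = (Particle.type v).other := by
  induction v with
  | nil => rfl
  | cons a v ih => exact congrArg Ball.other ih

/-- The lifetimes of the descendants of the offspring `b` of the initial particle. -/
def subtreeLifetimes (T : Particle → ℝ) (b : Bool) : Particle → ℝ := fun v => T (v ++ [b])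

/-- The head of a list is the most recent generation, so its last entry names the child of the
initial particle from which the line descends. -/
theorem birthTime_concat (T : Particle → ℝ) (v : Particle) (b : Bool) :
    birthTime T (v ++ [b]) = T [] + birthTime (subtreeLifetimes T b) v := by
  induction v with
  | nil => simp [birthTime]
  | cons a v ih =>
    change birthTime T (v ++ [b]) + T (v ++ [b]) = _
    rw [ih, add_assoc]
    rfl

theorem birthTime_nonneg {T : Particle → ℝ} (hT : ∀ v, 0 ≤ T v) (v : Particle) :
    0 ≤ birthTime T v := by
  induction v with
  | nil => exact le_rfl
  | cons a v ih => exact add_nonneg ih (hT v)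

/-- The number of particles of type `c` that are present at time `t`. -/
def typeCount (c : Ball) (T : Particle → ℝ) (t : ℝ) : ℕ∞ :=
  {v ∈ aliveAt T t | Particle.type v = c}.encard

theorem concat_mem_aliveAt {T : Particle → ℝ} {t : ℝ} {v : Particle} {b : Bool} :
    v ++ [b] ∈ aliveAt T t ↔ v ∈ aliveAt (subtreeLifetimes T b) (t - T []) := by
  simp only [aliveAt, mem_ofPred_eq, birthTime_concat]
  change _ ∧ t < T [] + birthTime (subtreeLifetimes T b) v + subtreeLifetimes T b v ↔ _
  constructor <;> rintro ⟨h1, h2⟩ <;> constructor <;> linarith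

theorem Ball.other_eq_iff {c d : Ball} : c.other = d ↔ c = d.other := by
  cases c <;> cases d <;> simp [Ball.other]

/-- No descendant is born before `T []`. Nonnegativity is asked only of the subtrees, since the
lemma is applied with the first lifetime fixed and almost all choices of the others. -/
theorem typeCount_of_lt {T : Particle → ℝ} {t : ℝ} (ht : 0 ≤ t) (h : t < T [])
    (h0 : ∀ b v, 0 ≤ subtreeLifetimes T b v) (c : Ball) :
    typeCount c T t = if c = Ball.x then 1 else 0 := by
  have : aliveAt T t = {[]} := by
    ext v
    rcases List.eq_nil_or_concat v with rfl | ⟨u, b, rfl⟩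
    · simp [aliveAt, birthTime, ht, h]
    · rw [List.concat_eq_append, concat_mem_aliveAt]
      have := birthTime_nonneg (h0 b) u
      simp only [aliveAt, mem_ofPred_eq, mem_singleton_iff, List.append_eq_nil_iff,
        List.cons_ne_nil, and_false, iff_false, not_and]
      intro h1
      linarith
  rw [typeCount, this]
  split_ifs with hc
  · rw [← Set.encard_singleton ([] : Particle)]
    congr 1
    ext v
    simp only [mem_singleton_iff, mem_ofPred_eq, and_iff_left_iff_imp]
    rintro rfl
    exact hc.symm
  · rw [Set.encard_eq_zero, Set.eq_empty_iff_forall_notMem]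
    rintro v ⟨hv, hv'⟩
    rw [mem_singleton_iff.1 hv] at hv'
    exact hc hv'.symm

theorem typeCount_of_le {T : Particle → ℝ} {t : ℝ} (h : T [] ≤ t) (c : Ball) :
    typeCount c T t = typeCount c.other (subtreeLifetimes T false) (t - T []) +
      typeCount c.other (subtreeLifetimes T true) (t - T []) := by
  have hinj (b : Bool) : Function.Injective fun v : Particle => v ++ [b] :=
    fun u v huv => List.append_cancel_right huv
  unfold typeCount
  rw [← (hinj false).encard_image
      {v ∈ aliveAt (subtreeLifetimes T false) (t - T []) | Particle.type v = c.other},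
    ← (hinj true).encard_image
      {v ∈ aliveAt (subtreeLifetimes T true) (t - T []) | Particle.type v = c.other},
    ← Set.encard_union_eq]
  · congr 1
    ext v
    rcases List.eq_nil_or_concat v with rfl | ⟨u, b, rfl⟩
    · have h1 : ([] : Particle) ∉ aliveAt T t := fun h' => by
        have := h'.2
        simp only [birthTime] at this
        linarith
      simp [h1]
    · have hm (a : Bool) : u ++ [b] ∈ (fun v : Particle => v ++ [a]) ''
          {v ∈ aliveAt (subtreeLifetimes T a) (t - T []) | Particle.type v = c.other} ↔
          b = a ∧ u ∈ aliveAt (subtreeLifetimes T a) (t - T []) ∧ Particle.type u = c.other := by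
        constructor
        · rintro ⟨v, hv, huv⟩
          obtain ⟨rfl, hba⟩ := List.append_inj' huv rfl
          exact ⟨(List.singleton_inj.1 hba).symm, hv⟩
        · rintro ⟨rfl, hu⟩
          exact ⟨u, hu, rfl⟩
      rw [List.concat_eq_append, mem_union, hm, hm, mem_ofPred_eq, concat_mem_aliveAt,
        Particle.type_concat, Ball.other_eq_iff]
      cases b <;> simp
  · rw [Set.disjoint_left]
    rintro _ ⟨u, -, rfl⟩ ⟨v, -, huv⟩
    simp at huv

theorem measurable_birthTime (v : Particle) : Measurable fun T : Particle → ℝ => birthTime T v := by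
  induction v with
  | nil => exact measurable_const
  | cons a v ih => exact ih.add (measurable_pi_apply v)

/-- Joint measurability in lifetimes and time is needed because conditioning on the first lifetime
shifts the time and then integrates over the shift. -/
theorem measurable_typeCount (c : Ball) :
    Measurable fun p : (Particle → ℝ) × ℝ => typeCount c p.1 p.2 := by
  refine measurable_encard.comp (measurable_set_iff.2 fun v => measurableSet_setOfPred.1 ?_)
  have hb : Measurable fun p : (Particle → ℝ) × ℝ => birthTime p.1 v :=
    (measurable_birthTime v).comp measurable_fst
  have hv : Measurable fun p : (Particle → ℝ) × ℝ => p.1 v :=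
    (measurable_pi_apply v).comp measurable_fst
  exact ((measurableSet_le hb measurable_snd).inter
    (measurableSet_lt measurable_snd (hb.add hv))).inter (MeasurableSet.const _)

/-! ### The law of the lifetimes -/

instance : IsProbabilityMeasure (expMeasure 1) := isProbabilityMeasure_expMeasure one_pos

/-- The joint law of independent lifetimes that are exponential of rate `1`. -/
def lifetimeLaw : Measure (Particle → ℝ) := Measure.infinitePi fun _ => expMeasure 1

instance : IsProbabilityMeasure lifetimeLaw := by unfold lifetimeLaw; infer_instance

theorem IsYuleLifetimes.map_eq {Ω : Type*} [MeasurableSpace Ω] {μ : Measure Ω}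
    {T : Particle → Ω → ℝ} (hT : IsYuleLifetimes μ T) :
    μ.map (fun ω v => T v ω) = lifetimeLaw := by
  rw [hT.indep.map_fun_eq_infinitePi_map₀' fun v => (hT.hasLaw v).aemeasurable, lifetimeLaw]
  congr 1
  ext1 v
  exact (hT.hasLaw v).map_eq

theorem integral_expMeasure {E : Type*} [NormedAddCommGroup E] [NormedSpace ℝ E] (f : ℝ → E) :
    ∫ s, f s ∂expMeasure 1 = ∫ s in Ioi 0, Real.exp (-s) • f s := by
  have h : expMeasure 1 = volume.withDensity fun s => ENNReal.ofReal (exponentialPDFReal 1 s) := rfl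
  rw [h, integral_withDensity_eq_integral_toReal_smul
    (measurable_exponentialPDFReal 1).ennreal_ofReal (by simp),
    ← integral_Ici_eq_integral_Ioi, ← integral_indicator measurableSet_Ici]
  refine integral_congr_ae (.of_forall fun s => ?_)
  change (exponentialPDF 1 s).toReal • f s = _
  by_cases hs : 0 ≤ s
  · simp [exponentialPDF_of_nonneg hs, hs, (Real.exp_pos _).le]
  · simp [exponentialPDF_of_neg (not_le.1 hs), hs]

theorem ae_expMeasure_nonneg : ∀ᵐ s ∂expMeasure 1, 0 ≤ s := by
  have h : expMeasure 1 = volume.withDensity fun s => ENNReal.ofReal (exponentialPDFReal 1 s) := rfl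
  rw [h, ae_withDensity_iff (measurable_exponentialPDFReal 1).ennreal_ofReal]
  refine .of_forall fun s hs => ?_
  by_contra! h
  exact hs (exponentialPDF_of_neg h)

theorem ae_lifetimeLaw_nonneg : ∀ᵐ T ∂lifetimeLaw, ∀ v, 0 ≤ T v :=
  ae_all_iff.2 fun v => (measurePreserving_eval_infinitePi (fun _ : Particle => expMeasure 1)
    v).quasiMeasurePreserving.ae ae_expMeasure_nonneg

/-- Assemble the lifetimes of all particles from that of the initial particle and those of the
descendants of its two offspring. -/
def glueLifetimes (p : ℝ × (Particle → ℝ) × (Particle → ℝ)) (v : Particle) : ℝ :=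
  match v.getLast? with
  | none => p.1
  | some b => (cond b p.2.2 p.2.1) v.dropLast

theorem glueLifetimes_concat (p : ℝ × (Particle → ℝ) × (Particle → ℝ)) (v : Particle) (b : Bool) :
    glueLifetimes p (v ++ [b]) = (cond b p.2.2 p.2.1) v := by
  simp [glueLifetimes]

theorem subtreeLifetimes_glueLifetimes (p : ℝ × (Particle → ℝ) × (Particle → ℝ)) (b : Bool) :
    subtreeLifetimes (glueLifetimes p) b = cond b p.2.2 p.2.1 :=
  funext fun v => glueLifetimes_concat p v b

theorem measurable_glueLifetimes : Measurable glueLifetimes := by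
  refine measurable_pi_lambda _ fun v => ?_
  rcases List.eq_nil_or_concat v with rfl | ⟨u, b, rfl⟩
  · exact measurable_fst
  · simp only [List.concat_eq_append, glueLifetimes_concat]
    cases b
    · exact (measurable_pi_apply u).comp measurable_snd.fst
    · exact (measurable_pi_apply u).comp measurable_snd.snd

/-- The particles `v` such that the particle `v ++ [b]` belongs to `s`. -/
def subtreeFinset (s : Finset Particle) (b : Bool) : Finset Particle :=
  s.preimage (fun v => v ++ [b]) fun _ _ _ _ h => List.append_cancel_right h

theorem mem_subtreeFinset {s : Finset Particle} {b : Bool} {v : Particle} :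
    v ∈ subtreeFinset s b ↔ v ++ [b] ∈ s := Finset.mem_preimage

open Classical in
theorem prod_particle_eq (s : Finset Particle) (f : Particle → ENNReal) :
    ∏ v ∈ s, f v = (if [] ∈ s then f [] else 1) *
      ((∏ v ∈ subtreeFinset s false, f (v ++ [false])) *
        ∏ v ∈ subtreeFinset s true, f (v ++ [true])) := by
  have hinj (b : Bool) : Function.Injective fun v : Particle => v ++ [b] :=
    fun _ _ h => List.append_cancel_right h
  have hs : s = (if [] ∈ s then {[]} else ∅) ∪
      ((subtreeFinset s false).image (fun v => v ++ [false]) ∪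
        (subtreeFinset s true).image (fun v => v ++ [true])) := by
    ext v
    rcases List.eq_nil_or_concat v with rfl | ⟨u, b, rfl⟩
    · by_cases h : ([] : Particle) ∈ s <;> simp [h]
    · cases b <;> by_cases h : ([] : Particle) ∈ s <;> simp [h, mem_subtreeFinset]
  conv_lhs => rw [hs]
  rw [Finset.prod_union, Finset.prod_union, Finset.prod_image (hinj false).injOn,
    Finset.prod_image (hinj true).injOn]
  · split_ifs <;> simp
  · rw [Finset.disjoint_left]
    intro v hv hv'
    obtain ⟨u, -, rfl⟩ := Finset.mem_image.1 hv
    obtain ⟨w, -, hw⟩ := Finset.mem_image.1 hv'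
    simp at hw
  · rw [Finset.disjoint_left]
    intro v hv hv'
    split_ifs at hv with h
    · rw [Finset.mem_singleton.1 hv] at hv'
      simp at hv'
    · simp at hv

/-- The branching property in law: a finite box pulls back to a product of three boxes, for the root
and the two subtrees, and such boxes determine the infinite product measure. -/
theorem map_glueLifetimes :
    ((expMeasure 1).prod (lifetimeLaw.prod lifetimeLaw)).map glueLifetimes = lifetimeLaw := by
  classical
  refine Measure.eq_infinitePi _ fun s t ht => ?_
  have hpre : glueLifetimes ⁻¹' Set.pi s t = (if [] ∈ s then t [] else univ) ×ˢ
      (Set.pi (subtreeFinset s false) (fun v => t (v ++ [false])) ×ˢ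
        Set.pi (subtreeFinset s true) (fun v => t (v ++ [true]))) := by
    ext p
    simp only [mem_preimage, Set.mem_pi, mem_prod, Finset.mem_coe, mem_subtreeFinset]
    constructor
    · intro h
      refine ⟨?_, fun v hv => ?_, fun v hv => ?_⟩
      · split_ifs with h0
        · exact h [] h0
        · trivial
      · simpa [glueLifetimes_concat] using h _ hv
      · simpa [glueLifetimes_concat] using h _ hv
    · rintro ⟨h1, h2, h3⟩ v hv
      rcases List.eq_nil_or_concat v with rfl | ⟨u, b, rfl⟩
      · rw [if_pos hv] at h1
        exact h1
      · rw [List.concat_eq_append] at hv ⊢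
        rw [glueLifetimes_concat]
        cases b
        · exact h2 u hv
        · exact h3 u hv
  rw [Measure.map_apply measurable_glueLifetimes
    (MeasurableSet.pi s.countable_toSet fun v _ => ht v), hpre, Measure.prod_prod,
    Measure.prod_prod, lifetimeLaw, Measure.infinitePi_pi _ fun v _ => ht _,
    Measure.infinitePi_pi _ fun v _ => ht _, prod_particle_eq s]
  congr 1
  split_ifs <;> simp

end

noncomputable section

/-! ### The probability generating functions -/

section
variable {𝕜 : Type*} [RCLike 𝕜]

/-- The power `x ^ n`, with the value `0` at `n = ∞`. -/
def enatPow (x : 𝕜) (n : ℕ∞) : 𝕜 := if n = ⊤ then 0 else x ^ n.toNat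

theorem enatPow_natCast (x : 𝕜) (n : ℕ) : enatPow x (n : ℕ∞) = x ^ n := by
  simp [enatPow]

theorem enatPow_top (x : 𝕜) : enatPow x ⊤ = 0 := by simp [enatPow]

/-- Since `0` is absorbing, as `∞` is for addition, the convention at `∞` keeps powers
multiplicative without first excluding explosion. -/
theorem enatPow_add (x : 𝕜) (m n : ℕ∞) : enatPow x (m + n) = enatPow x m * enatPow x n := by
  induction m using ENat.recTopCoe with
  | top => simp [enatPow_top]
  | coe m =>
    induction n using ENat.recTopCoe with
    | top => simp [enatPow_top]
    | coe n => rw [← Nat.cast_add]; simp only [enatPow_natCast, pow_add]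

theorem norm_enatPow_le {x : 𝕜} (hx : ‖x‖ ≤ 1) (n : ℕ∞) : ‖enatPow x n‖ ≤ 1 := by
  induction n using ENat.recTopCoe with
  | top => simp [enatPow_top]
  | coe n => rw [enatPow_natCast, norm_pow]; exact pow_le_one₀ (norm_nonneg _) hx

/-- The probability generating function of the number of particles of type `c` at time `t`. -/
def typePGF (x : 𝕜) (c : Ball) (t : ℝ) : 𝕜 := ∫ T, enatPow x (typeCount c T t) ∂lifetimeLaw

theorem norm_typePGF_le {x : 𝕜} (hx : ‖x‖ ≤ 1) (c : Ball) (t : ℝ) : ‖typePGF x c t‖ ≤ 1 := by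
  simpa [typePGF] using norm_integral_le_of_norm_le_const (μ := lifetimeLaw)
    (.of_forall fun T => norm_enatPow_le hx (typeCount c T t))

theorem measurable_enatPow_typeCount (x : 𝕜) (c : Ball) :
    Measurable fun p : (Particle → ℝ) × ℝ => enatPow x (typeCount c p.1 p.2) :=
  (measurable_of_countable (enatPow x)).comp (measurable_typeCount c)

theorem stronglyMeasurable_typePGF (x : 𝕜) (c : Ball) : StronglyMeasurable (typePGF x c) :=
  (measurable_enatPow_typeCount x c).stronglyMeasurable.integral_prod_left'

/-- The expectation given the lifetime `s` of the initial particle. -/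
theorem integral_enatPow_glueLifetimes (x : 𝕜) (c : Ball) {s t : ℝ} (ht : 0 ≤ t) :
    ∫ q, enatPow x (typeCount c (glueLifetimes (s, q)) t) ∂lifetimeLaw.prod lifetimeLaw =
      if t < s then urnWeight x c else typePGF x c.other (t - s) ^ 2 := by
  split_ifs with h
  · have h1 : ∀ᵐ q ∂lifetimeLaw.prod lifetimeLaw,
        enatPow x (typeCount c (glueLifetimes (s, q)) t) = urnWeight x c := by
      filter_upwards [Measure.quasiMeasurePreserving_fst.ae ae_lifetimeLaw_nonneg,
        Measure.quasiMeasurePreserving_snd.ae ae_lifetimeLaw_nonneg] with q hq1 hq2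
      rw [typeCount_of_lt ht h fun b v => ?_]
      · cases c
        · simpa [urnWeight] using enatPow_natCast x 1
        · simpa [urnWeight] using enatPow_natCast x 0
      · rw [subtreeLifetimes_glueLifetimes]
        cases b
        · exact hq1 v
        · exact hq2 v
    rw [integral_congr_ae h1]
    simp
  · have h1 (q : (Particle → ℝ) × (Particle → ℝ)) :
        enatPow x (typeCount c (glueLifetimes (s, q)) t) =
          enatPow x (typeCount c.other q.1 (t - s)) *
            enatPow x (typeCount c.other q.2 (t - s)) := by
      rw [typeCount_of_le (T := glueLifetimes (s, q)) (not_lt.1 h), enatPow_add,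
        subtreeLifetimes_glueLifetimes, subtreeLifetimes_glueLifetimes]
      rfl
    simp_rw [h1]
    rw [integral_prod_mul (fun T => enatPow x (typeCount c.other T (t - s)))
      fun T => enatPow x (typeCount c.other T (t - s)), sq]
    rfl

/-- The branching equation for the probability generating functions. -/
theorem typePGF_eq {x : 𝕜} (hx : ‖x‖ ≤ 1) (c : Ball) {t : ℝ} (ht : 0 ≤ t) :
    Real.exp t • typePGF x c t =
      urnWeight x c + ∫ s in (0 : ℝ)..t, Real.exp s • typePGF x c.other s ^ 2 := by
  have hmeas := (measurable_enatPow_typeCount x c).comp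
    (measurable_glueLifetimes.prodMk (measurable_const (a := t)))
  have hmeas' : Measurable fun T => enatPow x (typeCount c T t) :=
    (measurable_enatPow_typeCount x c).comp (measurable_id.prodMk measurable_const)
  have h1 : typePGF x c t = ∫ s in Ioi 0, Real.exp (-s) •
      if t < s then urnWeight x c else typePGF x c.other (t - s) ^ 2 := by
    rw [typePGF, ← map_glueLifetimes, integral_map measurable_glueLifetimes.aemeasurable
      hmeas'.aestronglyMeasurable, integral_prod,
      integral_expMeasure]
    · simp_rw [integral_enatPow_glueLifetimes x c ht]
    · exact .of_bound hmeas.aestronglyMeasurable 1 (.of_forall fun p => norm_enatPow_le hx _)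
  have hw : ‖urnWeight x c‖ ≤ 1 := by cases c <;> simp [urnWeight, hx]
  have hint : IntegrableOn (fun s => Real.exp (-s) •
      if t < s then urnWeight x c else typePGF x c.other (t - s) ^ 2) (Ioi 0) := by
    refine Integrable.mono' (g := fun s => Real.exp (-s)) ?_ ?_ (.of_forall fun s => ?_)
    · exact integrableOn_exp_neg_Ioi 0
    · refine AEStronglyMeasurable.smul (by fun_prop) (StronglyMeasurable.aestronglyMeasurable ?_)
      exact StronglyMeasurable.ite (measurableSet_lt measurable_const measurable_id)
        stronglyMeasurable_const (((stronglyMeasurable_typePGF x c.other).comp_measurable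
          (measurable_const.sub measurable_id)).pow 2)
    · rw [norm_smul, Real.norm_of_nonneg (Real.exp_pos _).le]
      refine mul_le_of_le_one_right (Real.exp_pos _).le ?_
      split_ifs
      · exact hw
      · rw [norm_pow]
        exact pow_le_one₀ (norm_nonneg _) (norm_typePGF_le hx _ _)
  rw [← Ioc_union_Ioi_eq_Ioi ht, setIntegral_union Ioc_disjoint_Ioi_same measurableSet_Ioi
    (hint.mono_set Ioc_subset_Ioi_self) (hint.mono_set (Ioi_subset_Ioi ht)),
    setIntegral_congr_fun (g := fun s => Real.exp (-s) • typePGF x c.other (t - s) ^ 2)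
      measurableSet_Ioc fun s hs => by simp [not_lt.2 hs.2],
    setIntegral_congr_fun (g := fun s => Real.exp (-s) • urnWeight x c)
      measurableSet_Ioi fun s hs => by simp [mem_Ioi.1 hs],
    integral_smul_const, integral_exp_neg_Ioi, ← intervalIntegral.integral_of_le ht] at h1
  -- Multiplying by `e^t` and reflecting `s ↦ t - s` removes `t` from the integrand.
  have h2 := intervalIntegral.integral_comp_sub_left (a := 0) (b := t)
    (fun s => Real.exp s • typePGF x c.other s ^ 2) t
  rw [sub_zero, sub_self] at h2
  rw [h1, smul_add, smul_smul, ← Real.exp_add, add_neg_cancel, Real.exp_zero, one_smul, add_comm,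
    ← h2, ← intervalIntegral.integral_smul]
  simp_rw [smul_smul, ← Real.exp_add, ← sub_eq_add_neg]

/-- The solution of the branching equation by the generating function of urn histories. -/
theorem urnSeries_branching {x : 𝕜} (hx : ‖x‖ ≤ 1) (c : Ball) {t : ℝ} (ht : 0 ≤ t) :
    ContinuousOn (fun s => Real.exp s •
        (Real.exp (-s) • urnSeries x c.other (1 - Real.exp (-s))) ^ 2) (uIcc 0 t) ∧
      urnSeries x c (1 - Real.exp (-t)) = urnWeight x c + ∫ s in (0 : ℝ)..t, Real.exp s •
        (Real.exp (-s) • urnSeries x c.other (1 - Real.exp (-s))) ^ 2 := by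
  have habs {s : ℝ} (hs : 0 ≤ s) : |1 - Real.exp (-s)| < 1 := by
    have h1 := Real.exp_pos (-s)
    have h2 : Real.exp (-s) ≤ 1 := Real.exp_le_one_iff.2 (by linarith)
    rw [abs_of_nonneg (by linarith)]
    linarith
  have hz (s : ℝ) : HasDerivAt (fun s => 1 - Real.exp (-s)) (Real.exp (-s)) s := by
    simpa using (hasDerivAt_neg s).exp.const_sub 1
  have hd (b : Ball) {s : ℝ} (hs : 0 ≤ s) : HasDerivAt (fun s => urnSeries x b (1 - Real.exp (-s)))
      (Real.exp s • (Real.exp (-s) • urnSeries x b.other (1 - Real.exp (-s))) ^ 2) s := by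
    refine ((hasDerivAt_urnSeries hx b (habs hs)).scomp s (hz s)).congr_deriv ?_
    rw [smul_pow, smul_smul, sq (Real.exp (-s)), ← mul_assoc, ← Real.exp_add, add_neg_cancel,
      Real.exp_zero, one_mul]
  have hnn {s : ℝ} (hs : s ∈ uIcc 0 t) : 0 ≤ s := by
    rw [uIcc_of_le ht] at hs
    exact hs.1
  have hcont : ContinuousOn (fun s => Real.exp s •
      (Real.exp (-s) • urnSeries x c.other (1 - Real.exp (-s))) ^ 2) (uIcc 0 t) := by
    have : ContinuousOn (fun s => urnSeries x c.other (1 - Real.exp (-s))) (uIcc 0 t) :=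
      fun s hs => (hd c.other (hnn hs)).continuousAt.continuousWithinAt
    fun_prop
  refine ⟨hcont, ?_⟩
  rw [intervalIntegral.integral_eq_sub_of_hasDerivAt (fun s hs => hd c (hnn hs))
    hcont.intervalIntegrable]
  simp [urnSeries_zero]

/-- Picard iteration for the difference of two solutions bounded by `1`: in `a² - b² = (a + b)(a -
b)` the first factor is at most `2`, so each integration contributes `2t/(n + 1)`. -/
theorem norm_typePGF_sub_le {x : 𝕜} (hx : ‖x‖ ≤ 1) (n : ℕ) (c : Ball) {t : ℝ} (ht : 0 ≤ t) :
    ‖Real.exp t • typePGF x c t - urnSeries x c (1 - Real.exp (-t))‖ ≤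
      2 * Real.exp t * ((2 * t) ^ n / n.factorial) := by
  have hU (b : Ball) {s : ℝ} (hs : 0 ≤ s) :
      ‖Real.exp (-s) • urnSeries x b (1 - Real.exp (-s))‖ ≤ 1 := by
    have h1 := Real.exp_pos (-s)
    have h2 : Real.exp (-s) ≤ 1 := Real.exp_le_one_iff.2 (by linarith)
    have h3 := norm_urnSeries_le hx b (z := 1 - Real.exp (-s)) (by linarith) (by linarith)
    rw [sub_sub_cancel] at h3
    rw [norm_smul, Real.norm_of_nonneg h1.le]
    calc _ ≤ Real.exp (-s) * (Real.exp (-s))⁻¹ := by gcongr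
      _ = 1 := mul_inv_cancel₀ h1.ne'
  have hsub (b : Ball) (s : ℝ) : Real.exp s • typePGF x b s - urnSeries x b (1 - Real.exp (-s)) =
      Real.exp s • (typePGF x b s - Real.exp (-s) • urnSeries x b (1 - Real.exp (-s))) := by
    rw [smul_sub, smul_smul, ← Real.exp_add, add_neg_cancel, Real.exp_zero, one_smul]
  induction n generalizing c t with
  | zero =>
    rw [hsub, norm_smul, Real.norm_of_nonneg (Real.exp_pos t).le]
    have := (norm_sub_le _ _).trans (add_le_add (norm_typePGF_le hx c t) (hU c ht))
    have := mul_le_mul_of_nonneg_left this (Real.exp_pos t).le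
    simp only [pow_zero, Nat.factorial_zero, Nat.cast_one, div_one, mul_one]
    linarith
  | succ n ih =>
    obtain ⟨hcont, hurn⟩ := urnSeries_branching hx c ht
    -- Only measurability and boundedness of `typePGF` are available here, so the comparison works
    -- with integral equations and not with derivatives.
    have hint : IntervalIntegrable (fun s => Real.exp s • typePGF x c.other s ^ 2)
        volume 0 t := by
      rw [intervalIntegrable_iff]
      refine Measure.integrableOn_of_bounded (M := Real.exp t) (by simp) ?_ ?_
      · exact ((Real.continuous_exp.stronglyMeasurable).smul
          ((stronglyMeasurable_typePGF x c.other).pow 2)).aestronglyMeasurable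
      · refine (ae_restrict_mem measurableSet_uIoc).mono fun s hs => ?_
        rw [uIoc_of_le ht] at hs
        rw [norm_smul, Real.norm_of_nonneg (Real.exp_pos s).le, norm_pow]
        calc _ ≤ Real.exp t * 1 := by
              gcongr
              · exact hs.2
              · exact pow_le_one₀ (norm_nonneg _) (norm_typePGF_le hx _ _)
          _ = _ := mul_one _
    rw [typePGF_eq hx c ht, hurn, add_sub_add_left_eq_sub,
      ← intervalIntegral.integral_sub hint hcont.intervalIntegrable]
    have hbound : ∀ s ∈ Ioc 0 t, ‖Real.exp s • typePGF x c.other s ^ 2 -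
        Real.exp s • (Real.exp (-s) • urnSeries x c.other (1 - Real.exp (-s))) ^ 2‖ ≤
        (4 * Real.exp t * 2 ^ n / n.factorial) * s ^ n := by
      intro s hs
      have h1 := ih c.other hs.1.le
      rw [← smul_sub, sq_sub_sq, ← mul_smul_comm, ← hsub, norm_mul]
      have h2 := (norm_add_le _ _).trans
        (add_le_add (norm_typePGF_le hx c.other s) (hU c.other hs.1.le))
      have h3 : Real.exp s ≤ Real.exp t := Real.exp_le_exp.2 hs.2
      have hs0 := hs.1.le
      calc _ ≤ (1 + 1) * (2 * Real.exp s * ((2 * s) ^ n / n.factorial)) := by gcongr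
        _ ≤ (1 + 1) * (2 * Real.exp t * ((2 * s) ^ n / n.factorial)) := by gcongr
        _ = _ := by rw [mul_pow]; ring
    refine (intervalIntegral.norm_integral_le_of_norm_le ht (.of_forall hbound)
      (Continuous.intervalIntegrable (by fun_prop) _ _)).trans_eq ?_
    rw [intervalIntegral.integral_const_mul, integral_pow, Nat.factorial_succ]
    push_cast
    have : (n.factorial : ℝ) ≠ 0 := by positivity
    have : (n : ℝ) + 1 ≠ 0 := by positivity
    field_simp
    ring

/-- The probability generating functions are given by the generating function of urn histories. -/
theorem typePGF_eq_urnSeries {x : 𝕜} (hx : ‖x‖ ≤ 1) (c : Ball) {t : ℝ} (ht : 0 ≤ t) :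
    typePGF x c t = Real.exp (-t) • urnSeries x c (1 - Real.exp (-t)) := by
  have h : ‖Real.exp t • typePGF x c t - urnSeries x c (1 - Real.exp (-t))‖ ≤ 0 := by
    have hlim := (FloorSemiring.tendsto_pow_div_factorial_atTop (2 * t)).const_mul
      (2 * Real.exp t)
    rw [mul_zero] at hlim
    exact ge_of_tendsto' hlim fun n => norm_typePGF_sub_le hx n c ht
  rw [← sub_eq_zero.1 (norm_le_zero_iff.1 h), smul_smul, ← Real.exp_add, neg_add_cancel,
    Real.exp_zero, one_smul]

/-- Splits the expectation over the disjoint events of a finite count. Their probabilities are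
summable, which justifies the exchange, and the event `∞` contributes `0` by the convention in
`enatPow`. -/
theorem hasSum_yuleCount {Ω : Type*} [MeasurableSpace Ω] {μ : Measure Ω} [IsProbabilityMeasure μ]
    {T : Particle → Ω → ℝ} (hT : IsYuleLifetimes μ T) {x : 𝕜} (hx : ‖x‖ ≤ 1) (t : ℝ) :
    HasSum (fun k : ℕ => (μ.real {ω | yuleCount (fun v => T v ω) t = (k : ℕ∞)} : 𝕜) * x ^ k)
      (typePGF x Ball.x t) := by
  have hN : Measurable fun T : Particle → ℝ => typeCount Ball.x T t :=
    (measurable_typeCount Ball.x).comp (measurable_id.prodMk measurable_const)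
  have hset (k : ℕ) : MeasurableSet {T : Particle → ℝ | typeCount Ball.x T t = (k : ℕ∞)} :=
    hN (measurableSet_singleton _)
  have hlaw (k : ℕ) : μ.real {ω | yuleCount (fun v => T v ω) t = (k : ℕ∞)} =
      lifetimeLaw.real {T | typeCount Ball.x T t = (k : ℕ∞)} := by
    rw [← hT.map_eq, measureReal_def, measureReal_def, Measure.map_apply_of_aemeasurable
      (aemeasurable_pi_iff.2 fun v => (hT.hasLaw v).aemeasurable) (hset k)]
    rfl
  set F : ℕ → (Particle → ℝ) → 𝕜 := fun k =>
    indicator {T | typeCount Ball.x T t = (k : ℕ∞)} fun _ => x ^ k with hF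
  have hFint (k : ℕ) : Integrable (F k) lifetimeLaw :=
    (integrable_const _).indicator (hset k)
  have hFsum (S : Particle → ℝ) : ∑' k, F k S = enatPow x (typeCount Ball.x S t) := by
    induction h : typeCount Ball.x S t using ENat.recTopCoe with
    | top => simp [hF, h, enatPow_top]
    | coe n =>
      rw [tsum_eq_single n fun k hk => by simp [hF, h, hk.symm], enatPow_natCast]
      simp [hF, h]
  have hnorm : Summable fun k => ∫ S, ‖F k S‖ ∂lifetimeLaw := by
    have hdisj : Pairwise (Function.onFun Disjoint
        fun k : ℕ => {T : Particle → ℝ | typeCount Ball.x T t = (k : ℕ∞)}) := by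
      intro i j hij
      refine Set.disjoint_left.2 fun S hi hj => hij ?_
      exact_mod_cast (show (i : ℕ∞) = typeCount Ball.x S t from hi.symm).trans hj
    refine Summable.of_nonneg_of_le (fun k => integral_nonneg fun S => norm_nonneg _)
      (fun k => ?_) (ENNReal.summable_toReal (f := fun k : ℕ =>
        lifetimeLaw {T : Particle → ℝ | typeCount Ball.x T t = (k : ℕ∞)}) ?_)
    · simp_rw [hF, norm_indicator_eq_indicator_norm]
      rw [integral_indicator (hset k), setIntegral_const, smul_eq_mul]
      refine mul_le_of_le_one_right measureReal_nonneg ?_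
      rw [norm_pow]
      exact pow_le_one₀ (norm_nonneg _) hx
    · rw [← measure_iUnion hdisj hset]
      exact measure_ne_top _ _
  have h := hasSum_integral_of_summable_integral_norm hFint hnorm
  simp_rw [hFsum] at h
  convert! h using 1
  ext k
  rw [hlaw, hF, integral_indicator (hset k), setIntegral_const, RCLike.real_smul_eq_coe_mul]

end
end

theorem mainTheorem9 {Ω : Type*} [MeasurableSpace Ω] (μ : Measure Ω) [IsProbabilityMeasure μ]
    (T : Particle → Ω → ℝ) (hT : IsYuleLifetimes μ T) (t : ℝ) (ht : 0 ≤ t) :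
    (∀ x : ℂ, ‖x‖ ≤ 1 →
      Summable (fun p : ℕ × ℕ => (urnCount p.1 p.2 : ℂ) * x ^ p.2 *
        ((1 - Real.exp (-t) : ℝ) : ℂ) ^ p.1 / (p.1.factorial : ℂ)) ∧
      HasSum (fun k : ℕ => (μ.real {ω | yuleCount (fun v => T v ω) t = (k : ℕ∞)} : ℂ) * x ^ k)
        (Real.exp (-t) * ∑' p : ℕ × ℕ, (urnCount p.1 p.2 : ℂ) * x ^ p.2 *
          ((1 - Real.exp (-t) : ℝ) : ℂ) ^ p.1 / (p.1.factorial : ℂ))) ∧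
    (∀ x : ℝ, |x| < 1 →
      HasSum (fun k : ℕ => μ.real {ω | yuleCount (fun v => T v ω) t = (k : ℕ∞)} * x ^ k)
        (Real.exp (-t) * urnClosedForm x (1 - Real.exp (-t)))) := by
  have h0 : 0 ≤ 1 - Real.exp (-t) := sub_nonneg.2 (Real.exp_le_one_iff.2 (by linarith))
  have h1 : 1 - Real.exp (-t) < 1 := sub_lt_self _ (Real.exp_pos _)
  refine ⟨fun x hx => ?_, fun x hx => ?_⟩
  · have hs := hasSum_urnCount_prod hx h0 h1
    refine ⟨hs.summable, ?_⟩
    have h := hasSum_yuleCount hT hx t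
    rw [typePGF_eq_urnSeries hx _ ht, Complex.real_smul, ← hs.tsum_eq] at h
    exact h
  · have h := hasSum_yuleCount hT (x := x) hx.le t
    rw [typePGF_eq_urnSeries (x := x) hx.le _ ht, smul_eq_mul,
      ← urnClosedForm_eq_urnSeries hx h0 h1] at h
    exact h
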